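/- Let $n\in\mathbb N$ and let $N\subseteq\mathbb R^n$ be a properly embedded $C^1$-submanifold without boundary (equivalently, a $C^1$-submanifold without boundary that is a closed subset of $\mathbb R^n$); the dimension of $N$ may differ between different points. Let $d$ denote the Euclidean distance and $d(N,X)=\inf_{Z\in N}d(Z,X)$. The medial axis of $N$ is the set of all $X\in\mathbb R^n$ for which there are two distinct points $Y',Y''\in N$ with $d(X,Y')=d(X,Y'')=d(N,X)$. The reach $\tau\in[0,\infty]$ of $N$ is the distance between $N$ and its medial axis, with $\tau=\infty$ if the medial axis is empty. For $Y\in N$, let $m$ be the dimension of $N$ at $Y$, and define the depth parameter $\rho_Y\colon\mathbb R^n\to\mathbb R_{\ge 0}$ as follows. - If $\tau=\infty$, then $\rho_Y(X)=d(N,X)$ (this covers the case $m=n$, in which necessarily $N=\mathbb R^n$). - If $\tau<\infty$ and $m=0$, then $\rho_Y(X)=d(X,Y)$. - If $\tau<\infty$ and $0<m<n$, then $\rho_Y(Y)=0$, and for $X\neq Y$ the value $\rho_Y(X)$ is the unique $q>0$ with $$\frac{x_1^2+\dots+x_m^2}{\tau q+q^2}+\frac{x_{m+1}^2+\dots+x_n^2}{q^2}=1,$$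 where $(x_1,\dots,x_n)$ are the coordinates of $X$ in an orthonormal coordinate system with origin $Y$ whose first $m$ axes are tangent and whose last $n-m$ axes are normal to $N$ at $Y$. That is, $X$ lies on the boundary of the ellipsoid centred at $Y$ with tangent semi-axes of length $\sqrt{\tau q+q^2}$ and normal semi-axes of length $q$. Then for every $Y\in N$ and every $X\in\mathbb R^n$, $$d(N,X)\le\rho_Y(X).$$ -/

import Mathlib

open scoped ENNReal

noncomputable section

/-- `N ⊆ ℝⁿ` is, near its point `x`, a `C¹`-submanifold without boundary of dimension `m`: some
`C¹`-diffeomorphism `φ` between open subsets of `ℝⁿ`, defined around `x`, straightens `N` to the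
slice on which the last `n - m` coordinates vanish. -/
def HasC1DimAt {n : ℕ} (N : Set (EuclideanSpace ℝ (Fin n))) (x : EuclideanSpace ℝ (Fin n))
    (m : ℕ) : Prop :=
  m ≤ n ∧ x ∈ N ∧
    ∃ φ : OpenPartialHomeomorph (EuclideanSpace ℝ (Fin n)) (EuclideanSpace ℝ (Fin n)),
      x ∈ φ.source ∧ ContDiffOn ℝ 1 φ φ.source ∧ ContDiffOn ℝ 1 φ.symm φ.target ∧
        ∀ y ∈ φ.source, (y ∈ N ↔ ∀ i : Fin n, m ≤ (i : ℕ) → φ y i = 0)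

/-- A properly embedded `C¹`-submanifold of `ℝⁿ` without boundary. The dimension may differ from
point to point. -/
structure IsProperC1Submanifold {n : ℕ} (N : Set (EuclideanSpace ℝ (Fin n))) : Prop where
  isProperMap_val : IsProperMap (Subtype.val : N → EuclideanSpace ℝ (Fin n))
  exists_dim : ∀ x ∈ N, ∃ m : ℕ, HasC1DimAt N x m

/-- The tangent space (as a linear subspace): the velocities at `x` of the curves in `N` that pass
through `x`. (At a point of a `C¹`-submanifold without boundary these velocities already form a
linear subspace; the span makes the definition meaningful for every set.) -/
def tangentSub {n : ℕ} (N : Set (EuclideanSpace ℝ (Fin n))) (x : EuclideanSpace ℝ (Fin n)) :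
    Submodule ℝ (EuclideanSpace ℝ (Fin n)) :=
  Submodule.span ℝ {v | ∃ γ : ℝ → EuclideanSpace ℝ (Fin n),
    γ 0 = x ∧ (∀ᶠ t in nhds (0 : ℝ), γ t ∈ N) ∧ HasDerivAt γ v 0}

/-- The normal space: the orthogonal complement of the tangent space. -/
def normalSub {n : ℕ} (N : Set (EuclideanSpace ℝ (Fin n))) (x : EuclideanSpace ℝ (Fin n)) :
    Submodule ℝ (EuclideanSpace ℝ (Fin n)) :=
  (tangentSub N x)ᗮ

/-- The medial axis: the points whose distance to `N` is attained in at least two points. -/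
def medialAxis {n : ℕ} (N : Set (EuclideanSpace ℝ (Fin n))) :
    Set (EuclideanSpace ℝ (Fin n)) :=
  {x | ∃ y₁ ∈ N, ∃ y₂ ∈ N, y₁ ≠ y₂ ∧
    dist x y₁ = Metric.infDist x N ∧ dist x y₂ = Metric.infDist x N}

/-- The reach: the distance between `N` and its medial axis, `∞` if the medial axis is empty. -/
def reach {n : ℕ} (N : Set (EuclideanSpace ℝ (Fin n))) : ℝ≥0∞ :=
  ⨅ y ∈ N, ⨅ x ∈ medialAxis N, edist y x

/-- `q > 0` and `A / (τ q + q²) + B / q² = 1`. -/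
def IsEllipsoidParam (τ A B q : ℝ) : Prop :=
  0 < q ∧ A / (τ * q + q ^ 2) + B / q ^ 2 = 1

theorem existsUnique_ellipsoidParam {τ A B : ℝ} (hτ : 0 ≤ τ) (hA : 0 ≤ A) (hB : 0 ≤ B)
    (hAB : 0 < A + B) : ∃! q : ℝ, IsEllipsoidParam τ A B q := by
  have hs : 0 < √(A + B) := Real.sqrt_pos.2 hAB
  have hs2 : √(A + B) ^ 2 = A + B := Real.sq_sqrt hAB.le
  set s := √(A + B) with hsdef
  have hq0 : 0 < (A + B) / (τ + s) := by positivity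
  set q₀ := (A + B) / (τ + s) with hq0def
  have hq0m : q₀ * (τ + s) = A + B := by rw [hq0def]; field_simp
  have hle : q₀ ≤ s := by nlinarith [mul_nonneg hq0.le hτ]
  have hcont : ContinuousOn (fun q : ℝ => A / (τ * q + q ^ 2) + B / q ^ 2) (Set.Icc q₀ s) := by
    refine ContinuousOn.add (ContinuousOn.div (by fun_prop) (by fun_prop) ?_)
      (ContinuousOn.div (by fun_prop) (by fun_prop) ?_)
    · intro q hq
      have : 0 < q := hq0.trans_le hq.1
      positivity
    · intro q hq
      have : 0 < q := hq0.trans_le hq.1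
      positivity
  have h1 : A / (τ * s + s ^ 2) + B / s ^ 2 ≤ 1 := by
    have : A / (τ * s + s ^ 2) ≤ A / s ^ 2 := by
      apply div_le_div_of_nonneg_left hA (by positivity)
      nlinarith [mul_nonneg hτ hs.le]
    have h2 : A / s ^ 2 + B / s ^ 2 = 1 := by
      rw [← add_div, hs2]; exact div_self hAB.ne'
    linarith
  have h0 : 1 ≤ A / (τ * q₀ + q₀ ^ 2) + B / q₀ ^ 2 := by
    have h3 : B / (τ * q₀ + q₀ ^ 2) ≤ B / q₀ ^ 2 := by
      apply div_le_div_of_nonneg_left hB (by positivity)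
      nlinarith [mul_nonneg hτ hq0.le]
    have h4 : 1 ≤ (A + B) / (τ * q₀ + q₀ ^ 2) := by
      rw [one_le_div (by positivity)]
      nlinarith
    rw [add_div] at h4
    linarith
  obtain ⟨q, hq, hq1⟩ := intermediate_value_Icc' hle hcont ⟨h1, h0⟩
  have anti : ∀ a b : ℝ, 0 < a → a < b →
      A / (τ * b + b ^ 2) + B / b ^ 2 < A / (τ * a + a ^ 2) + B / a ^ 2 := by
    intro a b ha hab
    have hb : 0 < b := ha.trans hab
    have e1 : a ^ 2 < b ^ 2 := by nlinarith
    have e2 : τ * a + a ^ 2 < τ * b + b ^ 2 := by nlinarith [mul_le_mul_of_nonneg_left hab.le hτ]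
    rcases hA.eq_or_lt with h | h
    · have hB' : 0 < B := by linarith
      rw [← h]
      simpa using div_lt_div_of_pos_left hB' (by positivity) e1
    · exact add_lt_add_of_lt_of_le (div_lt_div_of_pos_left h (by positivity) e2)
        (div_le_div_of_nonneg_left hB (by positivity) e1.le)
  refine ⟨q, ⟨hq0.trans_le hq.1, hq1⟩, ?_⟩
  rintro r ⟨hr, hr1⟩
  rcases lt_trichotomy r q with h | h | h
  · have := anti r q hr h
    simp only at hq1
    linarith
  · exact h
  · have := anti q r (hq0.trans_le hq.1) h
    simp only at hq1
    linarith

/-- The equation `(x₁² + ⋯ + x_m²) / (τ q + q²) + (x_{m+1}² + ⋯ + x_n²) / q² = 1` with `q > 0`,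
where `x₁, …, x_n` are the coordinates of `X` in a tangent-normal coordinate system at `Y` (the
first `m` axes tangent, the others normal to `N` at `Y`) and `τ` is the reach of `N`. The two sums of
squares are the squared lengths of the tangent and the normal part of `X - Y`. In other words, `X`
lies on the boundary of the tangent-normal `q`-ellipsoid at `Y`. -/
def IsDepthParam {n : ℕ} (N : Set (EuclideanSpace ℝ (Fin n)))
    (Y X : EuclideanSpace ℝ (Fin n)) (q : ℝ) : Prop :=
  IsEllipsoidParam (reach N).toReal
    (‖(tangentSub N Y).starProjection (X - Y)‖ ^ 2)
    (‖(normalSub N Y).starProjection (X - Y)‖ ^ 2) q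

theorem existsUnique_depthParam {n : ℕ} (N : Set (EuclideanSpace ℝ (Fin n)))
    {Y X : EuclideanSpace ℝ (Fin n)} (h : X ≠ Y) : ∃! q : ℝ, IsDepthParam N Y X q := by
  refine existsUnique_ellipsoidParam ENNReal.toReal_nonneg (sq_nonneg _) (sq_nonneg _) ?_
  have h1 := Submodule.norm_sq_eq_add_norm_sq_starProjection (X - Y) (tangentSub N Y)
  have h2 : 0 < ‖X - Y‖ := norm_pos_iff.2 (sub_ne_zero.2 h)
  unfold normalSub
  rw [← h1]
  positivity

open Classical in
/-- The depth parameter `ρ_Y(X)`. -/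
def depth {n : ℕ} (N : Set (EuclideanSpace ℝ (Fin n))) (Y X : EuclideanSpace ℝ (Fin n)) : ℝ :=
  if reach N = ∞ then Metric.infDist X N
  else if HasC1DimAt N Y 0 then dist X Y
  else if h : X = Y then 0
  else (existsUnique_depthParam N h).choose

end

/-! Let `τ` be the finite reach and `q` the depth parameter. For `τ = 0` the ellipsoid is a ball and
the bound is immediate. For `τ > 0`, clearing denominators shows that `X` lies in the closed
`q`-ellipsoid at `p` iff `F p = q‖X - p‖² + τ‖w_p‖²` is at most `(τ + q)q²`, where `w_p` is the
normal part of `X - p`. This holds with equality at `Y`, so a minimiser `p` of `F` over `N`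
satisfies it too. If `X - p` is normal at `p`, then `F p = (τ + q)‖X - p‖²`, whence `‖X - p‖ ≤ q`.

So it suffices that the tangent part `e` of `X - p` vanishes (`starProjection_eq_zero_of_isMin`).
Otherwise put `a = ‖e‖ > 0` and `b = ‖w_p‖`, which forces `b < q`. A step in `N` with tangent part
`h • e` changes `‖X - p‖²` by at most `-2ha² + O(h²)` and lets the normal length grow by at most
`ha²/τ + O(h²)`. Hence `F` changes by at most `-2ha²(q - b) + O(h²)`, contradicting minimality.

As `N` is only `C¹`, the normal projection cannot be differentiated. Its growth is controlled
instead by Federer's inequality `2τ⟪z - p, ν⟫ ≤ ‖z - p‖²‖ν‖` for `ν` normal at `p`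
(`IsProperC1Submanifold.inner_le`), applied at both ends of the step (`step_estimate`). -/

/-! ### Closed sets with unique nearest points: empty tangent balls. -/

section ClosedSets

open Metric Filter Topology

/-- The point `s • v` is the only maximiser of `⟪·, v⟫` on the closed ball of radius `s`. -/
theorem eq_smul_of_norm_le_of_inner_le {E : Type*} [NormedAddCommGroup E]
    [InnerProductSpace ℝ E] {a v : E} {s : ℝ} (hs : 0 ≤ s) (hv : ‖v‖ = 1)
    (ha : ‖a‖ ≤ s) (h : inner ℝ (s • v - a) v ≤ 0) : a = s • v := by
  rw [inner_sub_left, inner_smul_left, real_inner_self_eq_norm_sq, hv] at h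
  have h0 : ‖a - s • v‖ ^ 2 ≤ 0 := by
    rw [norm_sub_sq_real, inner_smul_right, norm_smul, hv, Real.norm_of_nonneg hs]
    simp at h
    nlinarith [norm_nonneg a]
  have h1 : ‖a - s • v‖ = 0 := by nlinarith [norm_nonneg (a - s • v)]
  exact sub_eq_zero.1 (norm_eq_zero.1 h1)

variable {E : Type*} [NormedAddCommGroup E] [InnerProductSpace ℝ E] [ProperSpace E]

/-- If `z` is the only nearest point of `N` to `y`, then the distance to `N` increases from `y` in
every direction that makes an acute angle with `y - z`. -/
theorem exists_infDist_lt_of_inner_pos {N : Set E} (hN : IsClosed N) (hne : N.Nonempty) {y z d : E}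
    (huniq : ∀ z' ∈ N, dist y z' = infDist y N → z' = z) (hd : 0 < inner ℝ d (y - z)) :
    ∃ ε : ℝ, 0 < ε ∧ ε ≤ 1 ∧ infDist y N < infDist (y + ε • d) N := by
  by_contra! hcon
  -- Nearest points of `y + ε k • d` subconverge to a nearest point of `y`, hence to `z`; expanding
  -- squares then forces `⟪d, y - z⟫ ≤ 0` in the limit.
  let ε : ℕ → ℝ := fun k => 1 / ((k : ℝ) + 1)
  have hε0 : ∀ k, 0 < ε k := fun k => by positivity
  have hε1 : ∀ k, ε k ≤ 1 := fun k => by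
    simp only [ε]
    rw [div_le_one (by positivity)]
    have : (0 : ℝ) ≤ k := by positivity
    linarith
  have hεt : Tendsto ε atTop (𝓝 0) := tendsto_one_div_add_atTop_nhds_zero_nat
  choose ζ hζN hζ using fun k => hN.exists_infDist_eq_dist hne (y + ε k • d)
  have hle : ∀ k, dist (y + ε k • d) (ζ k) ≤ infDist y N := fun k =>
    (hζ k).symm.trans_le (hcon _ (hε0 k) (hε1 k))
  have hmem : ∀ k, ζ k ∈ closedBall y (infDist y N + ‖d‖) := fun k => by
    rw [mem_closedBall, dist_comm]
    have h1 : dist y (y + ε k • d) ≤ ‖d‖ := by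
      rw [dist_self_add_right, norm_smul, Real.norm_of_nonneg (hε0 k).le]
      exact mul_le_of_le_one_left (norm_nonneg _) (hε1 k)
    linarith [dist_triangle y (y + ε k • d) (ζ k), hle k]
  obtain ⟨z', -, σ, hσ, hlim⟩ := (isCompact_closedBall y _).tendsto_subseq hmem
  have hz'N : z' ∈ N := hN.mem_of_tendsto hlim (Eventually.of_forall fun k => hζN _)
  have hεσ : Tendsto (fun k => ε (σ k)) atTop (𝓝 0) := hεt.comp hσ.tendsto_atTop
  have hyt : Tendsto (fun k => y + ε (σ k) • d) atTop (𝓝 y) := by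
    simpa using (hεσ.smul_const d).const_add y
  have hz' : z' = z := huniq z' hz'N <| le_antisymm
    (le_of_tendsto (hyt.dist hlim) (Eventually.of_forall fun k => hle _)) (infDist_le_dist_of_mem hz'N)
  subst hz'
  have hin : ∀ k, 2 * inner ℝ d (y - ζ (σ k)) + ε (σ k) * ‖d‖ ^ 2 ≤ 0 := fun k => by
    have h1 : dist (y + ε (σ k) • d) (ζ (σ k)) ≤ dist y (ζ (σ k)) :=
      (hle _).trans (infDist_le_dist_of_mem (hζN _))
    rw [dist_eq_norm, dist_eq_norm, add_sub_right_comm] at h1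
    have h2 := pow_le_pow_left₀ (norm_nonneg _) h1 2
    rw [norm_add_sq_real, inner_smul_right, norm_smul, real_inner_comm,
      Real.norm_of_nonneg (hε0 _).le] at h2
    have h3 : ε (σ k) * (2 * inner ℝ d (y - ζ (σ k)) + ε (σ k) * ‖d‖ ^ 2) ≤ 0 := by nlinarith
    exact nonpos_of_mul_nonpos_right h3 (hε0 _)
  have hlim2 : Tendsto (fun k => 2 * inner ℝ d (y - ζ (σ k)) + ε (σ k) * ‖d‖ ^ 2) atTop
      (𝓝 (2 * inner ℝ d (y - z') + 0 * ‖d‖ ^ 2)) :=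
    ((tendsto_const_nhds.inner (tendsto_const_nhds.sub hlim)).const_mul 2).add
      (hεσ.mul_const _)
  have := le_of_tendsto hlim2 (Eventually.of_forall hin)
  linarith

/-- Every point at distance less than `τ` from `N` has at most one nearest point in `N`. -/
def UniqueNearest (N : Set E) (τ : ℝ) : Prop :=
  ∀ x, infDist x N < τ → ∀ z ∈ N, ∀ z' ∈ N,
    dist x z = infDist x N → dist x z' = infDist x N → z = z'

/-- A gradient flow argument without a flow: let `y` maximise the distance to `N` on the closed
`s`-ball about `x`, and let `z` be its nearest point. Since the distance increases in every
direction at an acute angle with `y - z`, the vector `y - x` must be the longest one along `y - z`.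
So `x` lies between `z` and `y`, which makes `z` a nearest point of `x`; uniqueness gives `z = p`,
and `y` is on the ray. -/
theorem UniqueNearest.infDist_add {N : Set E} (hN : IsClosed N) {τ : ℝ} (hu : UniqueNearest N τ)
    {p v : E} (hp : p ∈ N) (hv : ‖v‖ = 1) {r s : ℝ} (hs : 0 ≤ s) (hsr : s ≤ r) (hr : 0 < r)
    (hτ : r + s < τ) (hx : infDist (p + r • v) N = r) : infDist (p + (r + s) • v) N = r + s := by
  set x := p + r • v with hxdef
  have hne : N.Nonempty := ⟨p, hp⟩
  have hxp : dist x p = infDist x N := by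
    rw [hx, hxdef, dist_self_add_left, norm_smul, hv, Real.norm_of_nonneg hr.le, mul_one]
  obtain ⟨y, hyB, hymax⟩ := (isCompact_closedBall x s).exists_isMaxOn (nonempty_closedBall.2 hs)
    (continuous_infDist_pt N).continuousOn
  have hyx : ‖y - x‖ ≤ s := by rwa [mem_closedBall, dist_eq_norm] at hyB
  have hry : r ≤ infDist y N := by
    have := hymax (mem_closedBall_self hs)
    simpa [hx] using this
  have hyr : infDist y N ≤ r + s := by
    have := infDist_le_infDist_add_dist (s := N) (x := y) (y := x)
    rw [dist_eq_norm] at this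
    linarith
  obtain ⟨z, hzN, hz⟩ := hN.exists_infDist_eq_dist hne y
  have hρ : 0 < infDist y N := hr.trans_le hry
  set ρ := infDist y N with hρdef
  set v' := ρ⁻¹ • (y - z) with hv'def
  have hyz : y - z = ρ • v' := by rw [hv'def, smul_inv_smul₀ hρ.ne']
  have hv' : ‖v'‖ = 1 := by
    rw [hv'def, norm_smul, ← dist_eq_norm, ← hz, norm_inv, Real.norm_of_nonneg hρ.le,
      inv_mul_cancel₀ hρ.ne']
  have hyeq : y - x = s • v' := by
    refine eq_smul_of_norm_le_of_inner_le hs hv' hyx (not_lt.1 fun hpos => ?_)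
    obtain ⟨ε, hε0, hε1, hlt⟩ := exists_infDist_lt_of_inner_pos hN hne (y := y) (z := z)
      (d := s • v' - (y - x))
      (fun z' hz' h => hu y (by linarith) z' hz' z hzN h hz.symm)
      (by rw [hyz, inner_smul_right]; positivity)
    -- The improved point is still in the ball, being a convex combination of `y` and `x + s • v'`.
    refine absurd (hymax ?_) (not_le.2 hlt)
    rw [mem_closedBall, dist_eq_norm]
    have e : y + ε • (s • v' - (y - x)) - x = (1 - ε) • (y - x) + ε • (s • v') := by module
    rw [e]
    refine (norm_add_le _ _).trans ?_
    rw [norm_smul, norm_smul, norm_smul, hv', Real.norm_of_nonneg hs, Real.norm_of_nonneg hε0.le,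
      Real.norm_of_nonneg (sub_nonneg.2 hε1)]
    nlinarith
  have hxz : x - z = (ρ - s) • v' := by
    have : x - z = (y - z) - (y - x) := by abel
    rw [this, hyz, hyeq, sub_smul]
  have hdxz : dist x z = ρ - s := by
    rw [dist_eq_norm, hxz, norm_smul, hv', Real.norm_of_nonneg (by linarith), mul_one]
  have hge : infDist x N ≤ dist x z := infDist_le_dist_of_mem hzN
  have hρeq : ρ = r + s := by linarith
  have hzp : z = p := hu x (by linarith) z hzN p hp (by linarith) hxp
  have hvv : v' = v := by
    have h1 : r • v' = r • v := by
      have : ρ - s = r := by linarith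
      rw [this, hzp, hxdef, add_sub_cancel_left] at hxz
      exact hxz.symm
    exact smul_right_injective E hr.ne' h1
  have hyfin : p + (r + s) • v = y := by
    have : y = x + s • v' := by rw [← hyeq]; abel
    rw [this, hvv, hxdef, add_smul, add_assoc]
  rw [hyfin, ← hρdef, hρeq]

/-- One extension can at most double the radius, so doubling is iterated until `t` is within reach.
-/
theorem UniqueNearest.infDist_of_le {N : Set E} (hN : IsClosed N) {τ : ℝ} (hu : UniqueNearest N τ)
    {p v : E} (hp : p ∈ N) (hv : ‖v‖ = 1) {r t : ℝ} (hr : 0 < r) (hrt : r ≤ t) (ht : t < τ)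
    (hx : infDist (p + r • v) N = r) : infDist (p + t • v) N = t := by
  obtain ⟨k, hk⟩ := pow_unbounded_of_one_lt (t / r) one_lt_two
  rw [div_lt_iff₀ hr] at hk
  induction k generalizing r with
  | zero => exact absurd hk (by simpa using hrt)
  | succ k ih =>
    by_cases h : t ≤ r + r
    · have := hu.infDist_add hN hp hv (s := t - r) (by linarith) (by linarith) hr (by linarith) hx
      simpa using this
    · push Not at h
      exact ih (r := r + r) (by linarith) h.le
        (hu.infDist_add hN hp hv hr.le le_rfl hr (by linarith) hx)
        (by rw [pow_succ] at hk; linarith)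

/-- If `p` is a nearest point of `N` to a point `x` at distance less than `τ`, then `N` does not meet
the open ball of radius `τ` that touches `N` at `p` in the direction of `x - p`. -/
theorem UniqueNearest.inner_le {N : Set E} (hN : IsClosed N) {τ : ℝ} (hu : UniqueNearest N τ)
    {x p z : E} (hp : p ∈ N) (hxp : dist x p = infDist x N) (hx : infDist x N < τ) (hz : z ∈ N) :
    2 * τ * inner ℝ (z - p) (x - p) ≤ ‖z - p‖ ^ 2 * ‖x - p‖ := by
  rcases eq_or_ne x p with rfl | hne
  · simp
  have hr : 0 < ‖x - p‖ := norm_pos_iff.2 (sub_ne_zero.2 hne)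
  rw [dist_eq_norm] at hxp
  set r := ‖x - p‖ with hrdef
  set v := r⁻¹ • (x - p) with hvdef
  have hv : ‖v‖ = 1 := by
    rw [hvdef, norm_smul, norm_inv, norm_norm, ← hrdef, inv_mul_cancel₀ hr.ne']
  have hxv : x - p = r • v := by rw [hvdef, smul_inv_smul₀ hr.ne']
  have hx' : infDist (p + r • v) N = r := by rw [← hxv, add_sub_cancel, hxp]
  have key : ∀ t, r ≤ t → t < τ → 2 * t * inner ℝ (z - p) v ≤ ‖z - p‖ ^ 2 := fun t hrt htτ => by
    have h1 := hu.infDist_of_le hN hp hv hr hrt htτ hx'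
    have h2 : t ≤ ‖(z - p) - t • v‖ := by
      have := infDist_le_dist_of_mem (x := p + t • v) hz
      rw [h1, dist_comm, dist_eq_norm] at this
      rwa [sub_sub]
    have h3 := pow_le_pow_left₀ (hr.le.trans hrt) h2 2
    rw [norm_sub_sq_real, inner_smul_right, norm_smul, hv,
      Real.norm_of_nonneg (hr.le.trans hrt)] at h3
    linarith
  -- The ray can only be extended to `t < τ`; the radius `τ` itself is obtained as a limit.
  have hlim : 2 * τ * inner ℝ (z - p) v ≤ ‖z - p‖ ^ 2 := by
    have hrτ : r < τ := hxp ▸ hx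
    have hc : Tendsto (fun t : ℝ => 2 * t * inner ℝ (z - p) v) (𝓝[<] τ)
        (𝓝 (2 * τ * inner ℝ (z - p) v)) := by
      apply Tendsto.mono_left _ nhdsWithin_le_nhds
      exact Continuous.tendsto (by fun_prop) τ
    refine le_of_tendsto hc ?_
    filter_upwards [Ioo_mem_nhdsLT hrτ] with t ht using key t ht.1.le ht.2
  rw [hxv, inner_smul_right]
  nlinarith

/-- If `ν` is normal to `N` at `p` in the infinitesimal sense, then `N` does not meet the open ball of
radius `τ` that touches `N` at `p` in the direction `ν`. -/
theorem UniqueNearest.inner_le_of_isLittleO {N : Set E} (hN : IsClosed N) {τ : ℝ} (hτ : 0 < τ)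
    (hu : UniqueNearest N τ) {p z ν : E} (hp : p ∈ N) (hz : z ∈ N) (hν : ‖ν‖ = 1)
    (ho : (fun y => inner ℝ (y - p) ν) =o[𝓝[N] p] fun y => y - p) :
    2 * τ * inner ℝ (z - p) ν ≤ ‖z - p‖ ^ 2 := by
  -- It is not known that `p` is nearest to `p + t • ν`. The inequality is applied at the true
  -- nearest point `ξ t`, and `t → 0`.
  choose ξ hξN hξ using fun t : ℝ => hN.exists_infDist_eq_dist ⟨p, hp⟩ (p + t • ν)
  have hpt : ∀ t : ℝ, 0 < t → infDist (p + t • ν) N ≤ t := fun t ht => by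
    refine (infDist_le_dist_of_mem hp).trans ?_
    rw [dist_self_add_left, norm_smul, hν, Real.norm_of_nonneg ht.le, mul_one]
  have hnt : ∀ t : ℝ, 0 < t → ‖t • ν - (ξ t - p)‖ ≤ t := fun t ht => by
    have h1 := hpt t ht
    rw [hξ t, dist_eq_norm] at h1
    rwa [show t • ν - (ξ t - p) = p + t • ν - ξ t by abel]
  have hquad : ∀ t : ℝ, 0 < t → ‖ξ t - p‖ ^ 2 ≤ 2 * t * inner ℝ (ξ t - p) ν := fun t ht => by
    have := pow_le_pow_left₀ (norm_nonneg _) (hnt t ht) 2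
    rw [norm_sub_sq_real, inner_smul_left, norm_smul, hν, Real.norm_of_nonneg ht.le,
      real_inner_comm] at this
    simp at this
    linarith
  have hto : Tendsto ξ (𝓝[>] 0) (𝓝[N] p) := by
    refine tendsto_nhdsWithin_iff.2 ⟨?_, Eventually.of_forall hξN⟩
    rw [tendsto_iff_norm_sub_tendsto_zero]
    have h2 : Tendsto (fun t : ℝ => 2 * t) (𝓝[>] 0) (𝓝 0) := by
      apply Tendsto.mono_left _ nhdsWithin_le_nhds
      exact (Continuous.tendsto (by fun_prop) _).trans (by simp)
    refine squeeze_zero' (Eventually.of_forall fun _ => norm_nonneg _) ?_ h2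
    filter_upwards [self_mem_nhdsWithin] with t ht
    have ht : 0 < t := ht
    have h3 : inner ℝ (ξ t - p) ν ≤ ‖ξ t - p‖ := by
      simpa [hν] using real_inner_le_norm (ξ t - p) ν
    nlinarith [hquad t ht, norm_nonneg (ξ t - p)]
  -- In `‖ξ t - p‖² ≤ 2t⟪ξ t - p, ν⟫` the inner product is `o(‖ξ t - p‖)`; one factor cancels. Thus
  -- the direction from `ξ t` to `p + t • ν` tends to `ν`.
  have hsmall : (fun t => ξ t - p) =o[𝓝[>] 0] fun t : ℝ => t := by
    rw [Asymptotics.isLittleO_iff]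
    intro c hc
    filter_upwards [(ho.comp_tendsto hto).def (half_pos hc), self_mem_nhdsWithin] with t h1 ht
    have ht : 0 < t := ht
    have h2 : inner ℝ (ξ t - p) ν ≤ c / 2 * ‖ξ t - p‖ := (le_abs_self _).trans h1
    have h3 : ‖ξ t - p‖ * ‖ξ t - p‖ ≤ c * t * ‖ξ t - p‖ := by
      nlinarith [hquad t ht]
    rw [Real.norm_of_nonneg ht.le]
    by_contra! h4
    exact absurd h3 (not_le.2 (mul_lt_mul_of_pos_right h4 ((by positivity : 0 < c * t).trans h4)))
  have hdiv : Tendsto (fun t : ℝ => t⁻¹ • (ξ t - p)) (𝓝[>] 0) (𝓝 0) :=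
    hsmall.tendsto_inv_smul_nhds_zero
  have hξp : Tendsto ξ (𝓝[>] 0) (𝓝 p) := tendsto_nhds_of_tendsto_nhdsWithin hto
  have hL : Tendsto (fun t : ℝ => 2 * τ * inner ℝ (z - ξ t) (ν - t⁻¹ • (ξ t - p))) (𝓝[>] 0)
      (𝓝 (2 * τ * inner ℝ (z - p) (ν - 0))) :=
    ((tendsto_const_nhds.sub hξp).inner (tendsto_const_nhds.sub hdiv)).const_mul _
  have hR : Tendsto (fun t : ℝ => ‖z - ξ t‖ ^ 2) (𝓝[>] 0) (𝓝 (‖z - p‖ ^ 2)) :=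
    (tendsto_const_nhds.sub hξp).norm.pow 2
  rw [sub_zero] at hL
  refine le_of_tendsto_of_tendsto hL hR ?_
  filter_upwards [Ioo_mem_nhdsGT hτ] with t ht
  have h1 := hu.inner_le hN (hξN t) (hξ t).symm ((hpt t ht.1).trans_lt ht.2) hz
  have e : p + t • ν - ξ t = t • ν - (ξ t - p) := by abel
  have e2 : t • ν - (ξ t - p) = t • (ν - t⁻¹ • (ξ t - p)) := by
    rw [smul_sub, smul_inv_smul₀ ht.1.ne']
  rw [e] at h1
  have h2 : ‖z - ξ t‖ ^ 2 * ‖t • ν - (ξ t - p)‖ ≤ ‖z - ξ t‖ ^ 2 * t :=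
    mul_le_mul_of_nonneg_left (hnt t ht.1) (sq_nonneg _)
  have h3 := h1.trans h2
  rw [e2, inner_smul_right] at h3
  refine le_of_mul_le_mul_right (a := t) ?_ ht.1
  linarith

end ClosedSets

/-! ### Tangent spaces in straightening charts. -/

section Tangent

open Metric Filter Topology

variable {n : ℕ}

/-- The subspace of `ℝⁿ` on which the last `n - m` coordinates vanish. -/
def coordSlice (n m : ℕ) : Submodule ℝ (EuclideanSpace ℝ (Fin n)) where
  carrier := {w | ∀ i : Fin n, m ≤ (i : ℕ) → w i = 0}
  add_mem' ha hb i hi := by simp [ha i hi, hb i hi]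
  zero_mem' i _ := by simp
  smul_mem' c a ha i hi := by simp [ha i hi]

/-- `φ` is a `C¹`-chart of `ℝⁿ` that straightens `N` to the slice of dimension `m`. -/
structure IsStraightening (N : Set (EuclideanSpace ℝ (Fin n))) (m : ℕ)
    (φ : OpenPartialHomeomorph (EuclideanSpace ℝ (Fin n)) (EuclideanSpace ℝ (Fin n))) : Prop where
  contDiffOn : ContDiffOn ℝ 1 φ φ.source
  contDiffOn_symm : ContDiffOn ℝ 1 φ.symm φ.target
  mem_iff : ∀ y ∈ φ.source, (y ∈ N ↔ φ y ∈ coordSlice n m)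

theorem HasC1DimAt.exists_isStraightening {N : Set (EuclideanSpace ℝ (Fin n))}
    {x : EuclideanSpace ℝ (Fin n)} {m : ℕ} (h : HasC1DimAt N x m) :
    ∃ φ, IsStraightening N m φ ∧ x ∈ φ.source := by
  obtain ⟨-, -, φ, hx, h1, h2, h3⟩ := h
  exact ⟨φ, ⟨h1, h2, h3⟩, hx⟩

namespace IsStraightening

variable {N : Set (EuclideanSpace ℝ (Fin n))} {m : ℕ}
  {φ : OpenPartialHomeomorph (EuclideanSpace ℝ (Fin n)) (EuclideanSpace ℝ (Fin n))}
  {p : EuclideanSpace ℝ (Fin n)}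

theorem hasFDerivAt (hφ : IsStraightening N m φ) (hp : p ∈ φ.source) :
    HasFDerivAt φ (fderiv ℝ φ p) p :=
  ((hφ.contDiffOn.contDiffAt (φ.open_source.mem_nhds hp)).differentiableAt one_ne_zero).hasFDerivAt

theorem hasStrictFDerivAt_symm (hφ : IsStraightening N m φ) (hp : p ∈ φ.source) :
    HasStrictFDerivAt φ.symm (fderiv ℝ φ.symm (φ p)) (φ p) :=
  (hφ.contDiffOn_symm.contDiffAt
    (φ.open_target.mem_nhds (φ.map_source hp))).hasStrictFDerivAt one_ne_zero

theorem fderiv_symm_fderiv (hφ : IsStraightening N m φ) (hp : p ∈ φ.source)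
    (e : EuclideanSpace ℝ (Fin n)) : fderiv ℝ φ.symm (φ p) (fderiv ℝ φ p e) = e := by
  have h1 := (hφ.hasStrictFDerivAt_symm hp).hasFDerivAt.comp p (hφ.hasFDerivAt hp)
  have h2 : HasFDerivAt (φ.symm ∘ φ) (ContinuousLinearMap.id ℝ _) p :=
    (hasFDerivAt_id p).congr_of_eventuallyEq (φ.eventually_left_inverse hp)
  exact DFunLike.congr_fun (h1.unique h2) e

theorem fderiv_fderiv_symm (hφ : IsStraightening N m φ) (hp : p ∈ φ.source)
    (w : EuclideanSpace ℝ (Fin n)) : fderiv ℝ φ p (fderiv ℝ φ.symm (φ p) w) = w := by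
  have h0 : HasFDerivAt φ (fderiv ℝ φ p) (φ.symm (φ p)) := by
    rw [φ.left_inv hp]; exact hφ.hasFDerivAt hp
  have h1 := h0.comp (φ p) (hφ.hasStrictFDerivAt_symm hp).hasFDerivAt
  have h2 : HasFDerivAt (φ ∘ φ.symm) (ContinuousLinearMap.id ℝ _) (φ p) :=
    (hasFDerivAt_id _).congr_of_eventuallyEq (φ.eventually_right_inverse (φ.map_source hp))
  exact DFunLike.congr_fun (h1.unique h2) w

/-- A curve in `N` has vanishing last coordinates in the chart; conversely, a straight line in the
slice pulls back to a curve in `N`. One chart thus describes the tangent spaces at all nearby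
points. -/
theorem mem_tangentSub_iff (hφ : IsStraightening N m φ) (hp : p ∈ φ.source) (hpN : p ∈ N)
    {e : EuclideanSpace ℝ (Fin n)} :
    e ∈ tangentSub N p ↔ fderiv ℝ φ p e ∈ coordSlice n m := by
  constructor
  · intro he
    have hle : tangentSub N p ≤ (coordSlice n m).comap (fderiv ℝ φ p).toLinearMap := by
      refine Submodule.span_le.2 ?_
      rintro v ⟨γ, rfl, hγN, hγ⟩
      have h1 : HasDerivAt (φ ∘ γ) (fderiv ℝ φ (γ 0) v) 0 :=
        (hφ.hasFDerivAt hp).comp_hasDerivAt 0 hγ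
      have hsrc : ∀ᶠ t in 𝓝 (0 : ℝ), γ t ∈ φ.source :=
        hγ.continuousAt (φ.open_source.mem_nhds hp)
      intro i hi
      have h2 : HasDerivAt (fun t => (φ ∘ γ) t i) (fderiv ℝ φ (γ 0) v i) 0 :=
        (EuclideanSpace.proj (𝕜 := ℝ) i).hasFDerivAt.comp_hasDerivAt 0 h1
      have h3 : HasDerivAt (fun t => (φ ∘ γ) t i) 0 0 :=
        (hasDerivAt_const 0 0).congr_of_eventuallyEq <| by
          filter_upwards [hγN, hsrc] with t h h'
          exact (hφ.mem_iff _ h').1 h i hi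
      exact h2.unique h3
    exact hle he
  · intro he
    refine Submodule.subset_span ⟨fun t => φ.symm (φ p + t • fderiv ℝ φ p e), ?_, ?_, ?_⟩
    · simp [φ.left_inv hp]
    · have hc : Continuous fun t : ℝ => φ p + t • fderiv ℝ φ p e := by fun_prop
      have : ∀ᶠ t in 𝓝 (0 : ℝ), φ p + t • fderiv ℝ φ p e ∈ φ.target := by
        refine hc.continuousAt (φ.open_target.mem_nhds ?_)
        simpa using φ.map_source hp
      filter_upwards [this] with t ht
      rw [hφ.mem_iff _ (φ.map_target ht), φ.right_inv ht]
      exact add_mem ((hφ.mem_iff p hp).1 hpN) ((coordSlice n m).smul_mem t he)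
    · have h1 : HasDerivAt (fun t : ℝ => φ p + t • fderiv ℝ φ p e) (fderiv ℝ φ p e) 0 := by
        simpa using ((hasDerivAt_id (0 : ℝ)).smul_const (fderiv ℝ φ p e)).const_add (φ p)
      have h2 : HasFDerivAt φ.symm (fderiv ℝ φ.symm (φ p))
          (φ p + (0 : ℝ) • fderiv ℝ φ p e) := by
        simpa using (hφ.hasStrictFDerivAt_symm hp).hasFDerivAt
      have h3 := h2.comp_hasDerivAt (0 : ℝ) h1
      rwa [hφ.fderiv_symm_fderiv hp] at h3

/-- A normal vector is, up to first order, perpendicular to the submanifold. -/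
theorem inner_isLittleO (hφ : IsStraightening N m φ) (hp : p ∈ φ.source) (hpN : p ∈ N)
    {ν : EuclideanSpace ℝ (Fin n)} (hν : ν ∈ normalSub N p) :
    (fun y => inner ℝ (y - p) ν) =o[𝓝[N] p] fun y => y - p := by
  have hcont : Tendsto φ (𝓝 p) (𝓝 (φ p)) := (hφ.hasFDerivAt hp).continuousAt
  have h1 : (fun y => φ.symm (φ y) - φ.symm (φ p) - fderiv ℝ φ.symm (φ p) (φ y - φ p))
      =o[𝓝 p] fun y => φ y - φ p :=
    (hasFDerivAt_iff_isLittleO.1 (hφ.hasStrictFDerivAt_symm hp).hasFDerivAt).comp_tendsto hcont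
  have h2 := (h1.trans_isBigO (hφ.hasFDerivAt hp).isBigO_sub).mono
    (nhdsWithin_le_nhds (s := N))
  have h3 := (((innerSL ℝ ν).isBigO_comp _ (𝓝[N] p)).trans_isLittleO h2)
  refine h3.congr' ?_ EventuallyEq.rfl
  filter_upwards [self_mem_nhdsWithin, nhdsWithin_le_nhds (φ.open_source.mem_nhds hp)] with y hy hys
  -- This tangent vector approximates `y - p` to first order and is killed by the product with `ν`.
  have ht : fderiv ℝ φ.symm (φ p) (φ y - φ p) ∈ tangentSub N p := by
    rw [hφ.mem_tangentSub_iff hp hpN, hφ.fderiv_fderiv_symm hp]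
    exact sub_mem ((hφ.mem_iff y hys).1 hy) ((hφ.mem_iff p hp).1 hpN)
  rw [innerSL_apply_apply, φ.left_inv hys, φ.left_inv hp, inner_sub_right,
    Submodule.inner_left_of_mem_orthogonal ht hν, sub_zero, real_inner_comm]

/-- The orthogonal projection of the submanifold to its tangent space covers a neighbourhood. -/
theorem eventually_exists_orthogonalProjectionOnto_eq (hφ : IsStraightening N m φ)
    (hp : p ∈ φ.source) (hpN : p ∈ N) {ε : ℝ} (hε : 0 < ε) :
    ∀ᶠ t in 𝓝 (0 : tangentSub N p), ∃ z ∈ N, dist z p < ε ∧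
      (tangentSub N p).orthogonalProjectionOnto (z - p) = t := by
  let a : coordSlice n m → EuclideanSpace ℝ (Fin n) := fun s => φ p + s
  have ha0 : a 0 = φ p := by simp [a]
  have hac : Continuous a := by fun_prop
  have ha : HasStrictFDerivAt a (coordSlice n m).subtypeL 0 :=
    (coordSlice n m).subtypeL.hasStrictFDerivAt.const_add (φ p)
  have hψ : HasStrictFDerivAt φ.symm (fderiv ℝ φ.symm (φ p)) (a 0) := by
    rw [ha0]; exact hφ.hasStrictFDerivAt_symm hp
  let f : coordSlice n m → tangentSub N p := fun s =>
    (tangentSub N p).orthogonalProjectionOnto (φ.symm (a s) - p)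
  have hf : HasStrictFDerivAt f ((tangentSub N p).orthogonalProjectionOnto ∘L
      (fderiv ℝ φ.symm (φ p) ∘L (coordSlice n m).subtypeL)) 0 :=
    (tangentSub N p).orthogonalProjectionOnto.hasStrictFDerivAt.comp 0 ((hψ.comp 0 ha).sub_const p)
  -- A surjective strict derivative makes `f` map neighbourhoods of `0` onto neighbourhoods of `0`.
  have hsurj : ((tangentSub N p).orthogonalProjectionOnto ∘L
      (fderiv ℝ φ.symm (φ p) ∘L (coordSlice n m).subtypeL)).range = ⊤ := by
    rw [LinearMap.range_eq_top]
    intro e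
    refine ⟨⟨fderiv ℝ φ p e, (hφ.mem_tangentSub_iff hp hpN).1 e.2⟩, ?_⟩
    simp [hφ.fderiv_symm_fderiv hp]
  have hf0 : f 0 = 0 := by simp [f, ha0, φ.left_inv hp]
  have hmap := hf.map_nhds_eq_of_surj hsurj
  rw [hf0] at hmap
  have hev : ∀ᶠ s in 𝓝 (0 : coordSlice n m), a s ∈ φ.target ∧ dist (φ.symm (a s)) p < ε := by
    have h1 : ∀ᶠ s in 𝓝 (0 : coordSlice n m), a s ∈ φ.target :=
      hac.continuousAt (φ.open_target.mem_nhds (ha0 ▸ φ.map_source hp))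
    have h2 : Tendsto (fun s => φ.symm (a s)) (𝓝 0) (𝓝 p) := by
      have := (hψ.comp 0 ha).hasFDerivAt.continuousAt.tendsto
      simpa [ha0, φ.left_inv hp] using this
    exact h1.and (h2 (ball_mem_nhds p hε))
  rw [← hmap, eventually_map]
  filter_upwards [hev] with s ⟨hs, hsd⟩
  refine ⟨φ.symm (a s), ?_, hsd, rfl⟩
  rw [hφ.mem_iff _ (φ.map_target hs), φ.right_inv hs]
  exact add_mem ((hφ.mem_iff p hp).1 hpN) s.2

end IsStraightening

theorem IsProperC1Submanifold.isClosed {N : Set (EuclideanSpace ℝ (Fin n))}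
    (hN : IsProperC1Submanifold N) : IsClosed N := by
  simpa using hN.isProperMap_val.isClosedMap.isClosed_range

/-- The tangent bundle of a properly embedded submanifold is a closed set. -/
theorem IsProperC1Submanifold.isClosed_tangentBundle {N : Set (EuclideanSpace ℝ (Fin n))}
    (hN : IsProperC1Submanifold N) :
    IsClosed {x : EuclideanSpace ℝ (Fin n) × EuclideanSpace ℝ (Fin n) |
      x.1 ∈ N ∧ x.2 ∈ tangentSub N x.1} := by
  refine isClosed_of_closure_subset fun x hx => ?_
  have hxN : x.1 ∈ N := by
    exact closure_minimal (fun y hy => hy.1) (hN.isClosed.preimage continuous_fst) hx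
  obtain ⟨m, hm⟩ := hN.exists_dim x.1 hxN
  obtain ⟨φ, hφ, hxs⟩ := hm.exists_isStraightening
  refine ⟨hxN, (hφ.mem_tangentSub_iff hxs hxN).2 fun i hi => ?_⟩
  by_contra hne
  -- Tangency at nearby points is the vanishing of coordinates of `fderiv ℝ φ y.1 y.2`, which is
  -- jointly continuous because `φ` is `C¹`; this is a closed condition.
  have hfd : ContinuousAt (fderiv ℝ φ) x.1 :=
    (hφ.contDiffOn.continuousOn_fderiv_of_isOpen φ.open_source le_rfl).continuousAt
      (φ.open_source.mem_nhds hxs)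
  have hc : ContinuousAt (fun y : EuclideanSpace ℝ (Fin n) × EuclideanSpace ℝ (Fin n) =>
      fderiv ℝ φ y.1 y.2) x :=
    (hfd.comp continuousAt_fst).clm_apply continuousAt_snd
  have hci := (EuclideanSpace.proj (𝕜 := ℝ) i).continuous.continuousAt.comp hc
  have hsrc : ∀ᶠ y in 𝓝 x, y.1 ∈ φ.source := continuousAt_fst (φ.open_source.mem_nhds hxs)
  obtain ⟨y, hy, hys, hyi⟩ := ((mem_closure_iff_frequently.1 hx).and_eventually
    (hsrc.and (hci.eventually_ne hne))).exists
  exact hyi ((hφ.mem_tangentSub_iff hys hy.1).1 hy.2 i hi)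

end Tangent

/-! ### Federer's inequality for submanifolds of positive reach. -/

section Reach

open Metric Filter Topology

variable {n : ℕ} {N : Set (EuclideanSpace ℝ (Fin n))}

/-- A point with two nearest points is on the medial axis, so its distance to `N` is at least the
reach. For infinite reach, `toReal` is `0` and the claim is vacuous. -/
theorem uniqueNearest_reach : UniqueNearest N (reach N).toReal := by
  intro x hx z hz z' hz' h h'
  by_contra hne
  have hmem : x ∈ medialAxis N := ⟨z, hz, z', hz', hne, h, h'⟩
  have h1 : reach N ≤ edist z x := iInf₂_le_of_le z hz (iInf₂_le x hmem)
  have h2 := ENNReal.toReal_mono (edist_ne_top z x) h1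
  rw [← dist_edist, dist_comm, h] at h2
  linarith

/-- The open balls of radius `reach N` that touch `N` do not meet `N`. -/
theorem IsProperC1Submanifold.inner_le (hN : IsProperC1Submanifold N)
    (hτ : 0 < (reach N).toReal) {p z ν : EuclideanSpace ℝ (Fin n)} (hp : p ∈ N) (hz : z ∈ N)
    (hν : ν ∈ normalSub N p) :
    2 * (reach N).toReal * inner ℝ (z - p) ν ≤ ‖z - p‖ ^ 2 * ‖ν‖ := by
  rcases eq_or_ne ν 0 with rfl | hν0
  · simp
  have hpos : 0 < ‖ν‖ := norm_pos_iff.2 hν0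
  obtain ⟨m, hm⟩ := hN.exists_dim p hp
  obtain ⟨φ, hφ, hps⟩ := hm.exists_isStraightening
  have h1 := uniqueNearest_reach.inner_le_of_isLittleO hN.isClosed hτ hp hz
    (ν := ‖ν‖⁻¹ • ν) (by rw [norm_smul, norm_inv, norm_norm, inv_mul_cancel₀ hpos.ne'])
    (hφ.inner_isLittleO hps hp ((normalSub N p).smul_mem _ hν))
  rw [inner_smul_right] at h1
  calc 2 * (reach N).toReal * inner ℝ (z - p) ν
      = 2 * (reach N).toReal * (‖ν‖⁻¹ * inner ℝ (z - p) ν) * ‖ν‖ := by field_simp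
    _ ≤ ‖z - p‖ ^ 2 * ‖ν‖ := mul_le_mul_of_nonneg_right h1 hpos.le

theorem IsProperC1Submanifold.abs_inner_le (hN : IsProperC1Submanifold N)
    (hτ : 0 < (reach N).toReal) {p z ν : EuclideanSpace ℝ (Fin n)} (hp : p ∈ N) (hz : z ∈ N)
    (hν : ν ∈ normalSub N p) :
    |inner ℝ (z - p) ν| ≤ ‖z - p‖ ^ 2 / (2 * (reach N).toReal) * ‖ν‖ := by
  have h1 := hN.inner_le hτ hp hz hν
  have h2 := hN.inner_le hτ hp hz (neg_mem hν)
  rw [inner_neg_right, norm_neg] at h2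
  rw [div_mul_eq_mul_div, le_div_iff₀ (by positivity), abs_eq_max_neg]
  rcases max_choice (inner ℝ (z - p) ν) (-inner ℝ (z - p) ν) with h | h <;> rw [h] <;> linarith

theorem starProjection_add_starProjection_normalSub (p v : EuclideanSpace ℝ (Fin n)) :
    (tangentSub N p).starProjection v + (normalSub N p).starProjection v = v :=
  Submodule.starProjection_add_starProjection_orthogonal v

theorem norm_sq_eq_tangent_add_normal (p v : EuclideanSpace ℝ (Fin n)) :
    ‖v‖ ^ 2 = ‖(tangentSub N p).starProjection v‖ ^ 2 + ‖(normalSub N p).starProjection v‖ ^ 2 :=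
  Submodule.norm_sq_eq_add_norm_sq_starProjection v _

theorem norm_normal_le_norm_sub {p v e : EuclideanSpace ℝ (Fin n)} (he : e ∈ tangentSub N p) :
    ‖(normalSub N p).starProjection v‖ ≤ ‖v - e‖ := by
  have h1 : (normalSub N p).starProjection e = 0 := by
    rw [Submodule.starProjection_apply_eq_zero_iff]
    exact Submodule.le_orthogonal_orthogonal _ he
  have h2 : (normalSub N p).starProjection v = (normalSub N p).starProjection (v - e) := by
    rw [map_sub, h1, sub_zero]
  rw [h2]
  exact Submodule.norm_starProjection_apply_le _ _

/-! ### Minimising the ellipsoid form over the submanifold. -/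

/-- The quadratic form of which the tangent-normal ellipsoids are sublevel sets. -/
noncomputable def ellipsoidForm (N : Set (EuclideanSpace ℝ (Fin n))) (τ q : ℝ)
    (X p : EuclideanSpace ℝ (Fin n)) : ℝ :=
  q * ‖X - p‖ ^ 2 + τ * ‖(normalSub N p).starProjection (X - p)‖ ^ 2

/-- The normal length is the minimum of `‖X - z - e‖` over tangent `e`. With `e` as a further
variable, a continuous coercive function is minimised over the tangent bundle, which is closed. -/
theorem IsProperC1Submanifold.exists_isMinOn_ellipsoidForm (hN : IsProperC1Submanifold N)
    (hne : N.Nonempty) {τ q : ℝ} (hτ : 0 < τ) (hq : 0 < q) (X : EuclideanSpace ℝ (Fin n)) :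
    ∃ p ∈ N, ∀ z ∈ N, ellipsoidForm N τ q X p ≤ ellipsoidForm N τ q X z := by
  obtain ⟨Y, hY⟩ := hne
  let S := {x : EuclideanSpace ℝ (Fin n) × EuclideanSpace ℝ (Fin n) |
      x.1 ∈ N ∧ x.2 ∈ tangentSub N x.1}
  let Ψ : EuclideanSpace ℝ (Fin n) × EuclideanSpace ℝ (Fin n) → ℝ := fun x =>
    q * ‖X - x.1‖ ^ 2 + τ * ‖X - x.1 - x.2‖ ^ 2
  have hΨ : ∀ z : EuclideanSpace ℝ (Fin n),
      Ψ (z, (tangentSub N z).starProjection (X - z)) = ellipsoidForm N τ q X z := fun z => by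
    have : X - z - (tangentSub N z).starProjection (X - z)
        = (normalSub N z).starProjection (X - z) := by
      rw [sub_eq_iff_eq_add', starProjection_add_starProjection_normalSub]
    simp only [Ψ, ellipsoidForm, this]
  have hcont : Continuous Ψ := by fun_prop
  set M := Ψ (Y, 0) with hM
  have hM0 : 0 ≤ M := by positivity
  let K := closedBall X (√(M / q)) ×ˢ
    closedBall (0 : EuclideanSpace ℝ (Fin n)) (√(M / q) + √(M / τ))
  have hK : IsCompact K := (isCompact_closedBall _ _).prod (isCompact_closedBall _ _)
  have hout : ∀ x, Ψ x ≤ M → x ∈ K := fun x hx => by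
    have h1 : ‖X - x.1‖ ≤ √(M / q) := by
      refine Real.le_sqrt_of_sq_le ?_
      rw [le_div_iff₀ hq]
      have : 0 ≤ τ * ‖X - x.1 - x.2‖ ^ 2 := by positivity
      simp only [Ψ] at hx
      linarith
    have h2 : ‖X - x.1 - x.2‖ ≤ √(M / τ) := by
      refine Real.le_sqrt_of_sq_le ?_
      rw [le_div_iff₀ hτ]
      have : 0 ≤ q * ‖X - x.1‖ ^ 2 := by positivity
      simp only [Ψ] at hx
      linarith
    refine ⟨by rwa [mem_closedBall, dist_comm, dist_eq_norm], ?_⟩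
    rw [mem_closedBall_zero_iff]
    have h3 := norm_sub_le (X - x.1) (X - x.1 - x.2)
    rw [sub_sub_cancel] at h3
    linarith
  obtain ⟨x, hxS, hx⟩ := hcont.continuousOn.exists_isMinOn' (s := S) hN.isClosed_tangentBundle
    (x₀ := (Y, 0)) ⟨hY, zero_mem _⟩ <| by
      filter_upwards [Filter.mem_inf_of_left hK.compl_mem_cocompact] with y hy
      exact (not_le.1 fun hle => hy (hout y hle)).le
  refine ⟨x.1, hxS.1, fun z hz => ?_⟩
  rw [← hΨ z]
  refine le_trans ?_ (hx (show (z, _) ∈ S from ⟨hz, Submodule.starProjection_apply_mem _ _⟩))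
  have := norm_normal_le_norm_sub (N := N) (v := X - x.1) hxS.2
  simp only [Ψ, ellipsoidForm]
  gcongr

/-- A step from `p` to `z` in `N` whose tangent part is `h` times the tangent part of `X - p`: how the
distance from `X` and the length of the normal part change. -/
theorem IsProperC1Submanifold.step_estimate (hN : IsProperC1Submanifold N) {τ : ℝ}
    (hτ0 : 0 < τ) (hτ : (reach N).toReal = τ) {X p z : EuclideanSpace ℝ (Fin n)} (hp : p ∈ N)
    (hz : z ∈ N) {h : ℝ} (h0 : 0 < h) (h1 : h ≤ 1) (hδ : ‖z - p‖ ≤ τ)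
    (ht : (tangentSub N p).starProjection (z - p) = h • (tangentSub N p).starProjection (X - p))
    {a b K : ℝ} (ha : ‖(tangentSub N p).starProjection (X - p)‖ = a)
    (hb : ‖(normalSub N p).starProjection (X - p)‖ = b) (hK : a ^ 2 / τ = K) :
    ‖X - z‖ ^ 2 ≤ (1 - h) ^ 2 * a ^ 2 + (b + K * h ^ 2) ^ 2 ∧
      ‖(normalSub N z).starProjection (X - z)‖ ≤ b + K * h + (K ^ 2 / τ + K) * h ^ 2 := by
  set e := (tangentSub N p).starProjection (X - p) with he
  set w := (normalSub N p).starProjection (X - p) with hw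
  set ν := (normalSub N p).starProjection (z - p) with hν
  set wz := (normalSub N z).starProjection (X - z) with hwz
  have hXp : e + w = X - p := starProjection_add_starProjection_normalSub p (X - p)
  have hzp : h • e + ν = z - p := ht ▸ starProjection_add_starProjection_normalSub p (z - p)
  have hνN : ν ∈ normalSub N p := Submodule.starProjection_apply_mem _ _
  have hwN : w ∈ normalSub N p := Submodule.starProjection_apply_mem _ _
  have heT : e ∈ tangentSub N p := Submodule.starProjection_apply_mem _ _
  have hwzN : wz ∈ normalSub N z := Submodule.starProjection_apply_mem _ _
  have ha0 : 0 ≤ a := ha ▸ norm_nonneg _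
  have hb0 : 0 ≤ b := hb ▸ norm_nonneg _
  have hK0 : 0 ≤ K := by rw [← hK]; positivity
  have hKτ : K * τ = a ^ 2 := by rw [← hK]; field_simp
  have hδsq : ‖z - p‖ ^ 2 = h ^ 2 * a ^ 2 + ‖ν‖ ^ 2 := by
    rw [norm_sq_eq_tangent_add_normal (N := N) p, ht, norm_smul, ← hν, ha,
      Real.norm_of_nonneg h0.le, mul_pow]
  set D := ‖z - p‖ ^ 2 with hD
  -- Federer's inequality at `p`, tested against the normal part `ν` of `z - p` itself.
  have hν1 : 2 * τ * ‖ν‖ ≤ D := by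
    have h2 := hN.inner_le (hτ ▸ hτ0) hp hz hνN
    rw [← hzp, inner_add_left, inner_smul_left,
      Submodule.inner_right_of_mem_orthogonal heT hνN, mul_zero, zero_add,
      real_inner_self_eq_norm_sq, hτ, hzp, ← hD] at h2
    rcases (norm_nonneg ν).eq_or_lt with h3 | h3
    · rw [← h3, mul_zero]; positivity
    · refine le_of_mul_le_mul_right (a := ‖ν‖) ?_ h3
      linarith
  have hDle : D ≤ τ ^ 2 := pow_le_pow_left₀ (norm_nonneg _) hδ 2
  -- With `D = h²a² + ‖ν‖²` this gives `D ≤ 2h²a²`, hence the quadratic bound on `‖ν‖`.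
  have hν2 : ‖ν‖ ^ 2 ≤ D / 2 := by
    have h2 : (2 * τ * ‖ν‖) ^ 2 ≤ D ^ 2 := pow_le_pow_left₀ (by positivity) hν1 2
    have h3 : D ^ 2 ≤ τ ^ 2 * D := by nlinarith [sq_nonneg ‖z - p‖]
    have h4 : τ ^ 2 * (4 * ‖ν‖ ^ 2) ≤ τ ^ 2 * D := by nlinarith
    have h5 := le_of_mul_le_mul_left h4 (by positivity)
    nlinarith [sq_nonneg ‖z - p‖]
  have hν3 : ‖ν‖ ≤ K * h ^ 2 := by
    refine le_of_mul_le_mul_left (a := τ) ?_ hτ0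
    rw [show τ * (K * h ^ 2) = h ^ 2 * (K * τ) by ring, hKτ]
    linarith
  have hD2 : D ≤ h ^ 2 * a ^ 2 + K ^ 2 * h ^ 4 := by
    have := pow_le_pow_left₀ (norm_nonneg ν) hν3 2
    rw [hδsq]
    linarith
  constructor
  · have h2 : X - z = (1 - h) • e + (w - ν) := by
      rw [sub_smul, one_smul, show (e - h • e + (w - ν)) = (e + w) - (h • e + ν) by abel, hXp, hzp]
      abel
    have hort : inner ℝ ((1 - h) • e) (w - ν) = 0 :=
      Submodule.inner_right_of_mem_orthogonal ((tangentSub N p).smul_mem _ heT)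
        (sub_mem hwN hνN)
    rw [h2, norm_add_sq_real, hort, norm_smul, mul_pow, ha, Real.norm_eq_abs, sq_abs]
    have h3 : ‖w - ν‖ ≤ b + K * h ^ 2 := (norm_sub_le _ _).trans (by rw [hb]; linarith)
    have := pow_le_pow_left₀ (norm_nonneg _) h3 2
    linarith
  · have hz1 : |inner ℝ (p - z) wz| ≤ D / (2 * τ) * ‖wz‖ := by
      have := hN.abs_inner_le (hτ ▸ hτ0) hz hp hwzN
      rwa [hτ, norm_sub_rev] at this
    have hself : ‖wz‖ ^ 2 = inner ℝ (X - z) wz := by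
      rw [← starProjection_add_starProjection_normalSub (N := N) z (X - z), ← hwz,
        inner_add_left, real_inner_self_eq_norm_sq, Submodule.inner_right_of_mem_orthogonal
        (Submodule.starProjection_apply_mem _ _) hwzN, zero_add]
    have hsplit : inner ℝ (X - z) wz = inner ℝ e wz + inner ℝ w wz + inner ℝ (p - z) wz := by
      rw [← inner_add_left, hXp, ← inner_add_left, sub_add_sub_cancel]
    -- Since `h • e = (z - p) - ν`, Federer's inequality at `z` bounds `h⟪e, wz⟫` by `(D / τ)‖wz‖`.
    -- As `D` is about `h²a²`, dividing by `h` leaves the growth rate `K = a²/τ`.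
    have hez : h * inner ℝ e wz = -inner ℝ (p - z) wz - inner ℝ ν wz := by
      rw [← inner_neg_left, neg_sub, ← hzp, inner_add_left, inner_smul_left]
      simp
    have hwle : inner ℝ w wz ≤ b * ‖wz‖ := hb ▸ real_inner_le_norm w wz
    have hνle : -inner ℝ ν wz ≤ ‖ν‖ * ‖wz‖ := (neg_le_abs _).trans (abs_real_inner_le_norm ν wz)
    have hνD : ‖ν‖ ≤ D / (2 * τ) := by
      rw [le_div_iff₀ (by positivity)]; linarith
    have hele : inner ℝ e wz ≤ D / τ / h * ‖wz‖ := by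
      rw [div_mul_eq_mul_div, le_div_iff₀ h0]
      have h2 : D / τ * ‖wz‖ = D / (2 * τ) * ‖wz‖ + D / (2 * τ) * ‖wz‖ := by field_simp; ring
      have h3 : ‖ν‖ * ‖wz‖ ≤ D / (2 * τ) * ‖wz‖ :=
        mul_le_mul_of_nonneg_right hνD (norm_nonneg _)
      linarith [neg_abs_le (inner ℝ (p - z) wz)]
    have htot : ‖wz‖ ^ 2 ≤ (D / τ / h + b + D / (2 * τ)) * ‖wz‖ := by
      rw [hself, hsplit]
      linarith [le_abs_self (inner ℝ (p - z) wz)]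
    have hD0 : 0 ≤ D := by positivity
    have hwzle : ‖wz‖ ≤ D / τ / h + b + D / (2 * τ) := by
      rcases (norm_nonneg wz).eq_or_lt with h3 | h3
      · rw [← h3]; positivity
      · refine le_of_mul_le_mul_right (a := ‖wz‖) ?_ h3
        linarith
    have hA : D / τ / h ≤ K * h + K ^ 2 / τ * h ^ 2 := by
      rw [div_div, div_le_iff₀ (by positivity)]
      have h2 : (K * h + K ^ 2 / τ * h ^ 2) * (τ * h) = K * τ * h ^ 2 + K ^ 2 * h ^ 3 := by
        field_simp
      rw [h2, hKτ]
      have : K ^ 2 * h ^ 4 ≤ K ^ 2 * h ^ 3 :=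
        mul_le_mul_of_nonneg_left (pow_le_pow_of_le_one h0.le h1 (by norm_num)) (sq_nonneg K)
      linarith
    have hB : D / (2 * τ) ≤ K * h ^ 2 := by
      rw [div_le_iff₀ (by positivity), show K * h ^ 2 * (2 * τ) = 2 * h ^ 2 * (K * τ) by ring, hKτ]
      linarith
    linarith

/-- At a minimum over `N` of the ellipsoid form, `X` lies on the normal space. -/
theorem IsProperC1Submanifold.starProjection_eq_zero_of_isMin (hN : IsProperC1Submanifold N)
    {τ q : ℝ}
    (hτ0 : 0 < τ) (hτ : (reach N).toReal = τ) (hq : 0 < q) {X p : EuclideanSpace ℝ (Fin n)}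
    (hp : p ∈ N) (hmin : ∀ z ∈ N, ellipsoidForm N τ q X p ≤ ellipsoidForm N τ q X z)
    (hle : ellipsoidForm N τ q X p ≤ (τ + q) * q ^ 2) :
    (tangentSub N p).starProjection (X - p) = 0 := by
  by_contra hne
  have ha0 : 0 < ‖(tangentSub N p).starProjection (X - p)‖ := norm_pos_iff.2 hne
  have hb0 : 0 ≤ ‖(normalSub N p).starProjection (X - p)‖ := norm_nonneg _
  have hXp := norm_sq_eq_tangent_add_normal (N := N) p (X - p)
  unfold ellipsoidForm at hle hmin
  set a := ‖(tangentSub N p).starProjection (X - p)‖ with ha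
  set b := ‖(normalSub N p).starProjection (X - p)‖ with hb
  rw [hXp] at hle hmin
  have hbq : b < q := by
    have h1 : (τ + q) * b ^ 2 < (τ + q) * q ^ 2 := by
      have : 0 < q * a ^ 2 := by positivity
      linarith
    exact lt_of_pow_lt_pow_left₀ 2 hq.le (lt_of_mul_lt_mul_left h1 (by positivity))
  obtain ⟨m, hm⟩ := hN.exists_dim p hp
  obtain ⟨φ, hφ, hps⟩ := hm.exists_isStraightening
  let K := a ^ 2 / τ
  let C := K ^ 2 / τ + K
  have hKτ : τ * K = a ^ 2 := by simp only [K]; field_simp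
  -- `h * G h` is the upper bound that `step_estimate` gives for the change of the form. The
  -- constant `K` makes `G 0 = -2a²(q - b)`.
  let G : ℝ → ℝ := fun h =>
    q * ((h - 2) * a ^ 2 + 2 * b * K * h + K ^ 2 * h ^ 3)
      + τ * (2 * b * (K + C * h) + h * (K + C * h) ^ 2)
  have hG0 : G 0 < 0 := by
    have : G 0 = -2 * a ^ 2 * (q - b) := by
      simp only [G]
      linear_combination 2 * b * hKτ
    rw [this]
    have : 0 < a ^ 2 * (q - b) := mul_pos (by positivity) (sub_pos.2 hbq)
    linarith
  have hGc : Continuous G := by fun_prop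
  have hev1 : ∀ᶠ h in 𝓝[>] (0 : ℝ), G h < 0 :=
    nhdsWithin_le_nhds (hGc.continuousAt.eventually_lt_const hG0)
  let t : ℝ → tangentSub N p := fun h =>
    h • (tangentSub N p).orthogonalProjectionOnto (X - p)
  have htc : Tendsto t (𝓝[>] 0) (𝓝 0) := by
    have : Continuous t := by fun_prop
    exact (this.tendsto' 0 0 (by simp [t])).mono_left nhdsWithin_le_nhds
  have hev2 := htc.eventually (hφ.eventually_exists_orthogonalProjectionOnto_eq hps hp hτ0)
  obtain ⟨h, hGh, ⟨z, hz, hzd, hzt⟩, hh0, hh1⟩ :=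
    (hev1.and (hev2.and (Ioc_mem_nhdsGT one_pos))).exists
  have hzt' : (tangentSub N p).starProjection (z - p)
      = h • (tangentSub N p).starProjection (X - p) := by
    rw [Submodule.starProjection_apply, hzt]
    rfl
  obtain ⟨e1, e2⟩ := hN.step_estimate hτ0 hτ hp hz hh0 hh1 (dist_eq_norm z p ▸ hzd.le) hzt'
    ha.symm hb.symm rfl
  have e3 := pow_le_pow_left₀ (norm_nonneg _) e2 2
  have e4 := hmin z hz
  have e5 : q * (a ^ 2 + b ^ 2) + τ * b ^ 2 ≤
      q * ((1 - h) ^ 2 * a ^ 2 + (b + K * h ^ 2) ^ 2) + τ * (b + K * h + C * h ^ 2) ^ 2 :=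
    e4.trans (add_le_add (mul_le_mul_of_nonneg_left e1 hq.le) (mul_le_mul_of_nonneg_left e3 hτ0.le))
  have e6 : 0 ≤ h * G h := by
    simp only [G]
    linarith
  exact absurd e6 (not_le.2 (mul_neg_of_pos_of_neg hh0 hGh))

end Reach

theorem IsProperC1Submanifold.infDist_le_of_isDepthParam {n : ℕ}
    {N : Set (EuclideanSpace ℝ (Fin n))} (hN : IsProperC1Submanifold N)
    {X Y : EuclideanSpace ℝ (Fin n)} (hY : Y ∈ N) {q : ℝ} (h : IsDepthParam N Y X q) :
    Metric.infDist X N ≤ q := by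
  obtain ⟨hq, heq⟩ := h
  have hXY := norm_sq_eq_tangent_add_normal (N := N) Y (X - Y)
  generalize hτ : (reach N).toReal = τ at heq
  have hτ0 : 0 ≤ τ := hτ ▸ ENNReal.toReal_nonneg
  -- For `τ = 0` both semi-axes equal `q`, so `q = ‖X - Y‖`.
  rcases hτ0.eq_or_lt with h0 | h0
  · refine (Metric.infDist_le_dist_of_mem hY).trans ?_
    rw [← h0, zero_mul, zero_add, ← add_div, ← hXY, div_eq_one_iff_eq (by positivity)] at heq
    rw [dist_eq_norm]
    exact le_of_eq ((sq_eq_sq₀ (norm_nonneg _) hq.le).1 heq)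
  obtain ⟨p, hp, hmin⟩ := hN.exists_isMinOn_ellipsoidForm ⟨Y, hY⟩ h0 hq X
  have hval : ellipsoidForm N τ q X Y = (τ + q) * q ^ 2 := by
    rw [ellipsoidForm, hXY]
    field_simp at heq
    linarith
  have hle := hval ▸ hmin Y hY
  have hz := hN.starProjection_eq_zero_of_isMin h0 hτ hq hp hmin hle
  have hXp := norm_sq_eq_tangent_add_normal (N := N) p (X - p)
  rw [hz, norm_zero, zero_pow two_ne_zero, zero_add] at hXp
  rw [ellipsoidForm, ← hXp, ← add_mul, add_comm q τ] at hle
  refine (Metric.infDist_le_dist_of_mem hp).trans ?_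
  rw [dist_eq_norm]
  exact (sq_le_sq₀ (norm_nonneg _) hq.le).1 (le_of_mul_le_mul_left hle (by positivity))

theorem mainTheorem4 {n : ℕ} (N : Set (EuclideanSpace ℝ (Fin n)))
    (hN : IsProperC1Submanifold N) (Y : EuclideanSpace ℝ (Fin n)) (hY : Y ∈ N)
    (X : EuclideanSpace ℝ (Fin n)) :
    Metric.infDist X N ≤ depth N Y X := by
  unfold depth
  split_ifs with h1 h2 h3
  · exact le_rfl
  · exact Metric.infDist_le_dist_of_mem hY
  · rw [h3, Metric.infDist_zero_of_mem hY]
  · exact hN.infDist_le_of_isDepthParam hY (existsUnique_depthParam N h3).choose_spec.1
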